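/- Let $\rho\in\mathbb R$, $L>0$ and $I=[0,L]$. Let $Q$ be an $H^2$ solution on $I$ of the cubic nonlinear Schrödinger equation $iQ_Z+Q_{TT}+\rho|Q|^2Q=0$, that is, $Q\in C(I,H^2(\mathbb R))\cap C^1(I,L^2(\mathbb R))$ and the equation holds in $L^2(\mathbb R)$ for every $Z\in I$. Put $W=Q_T$. Then $W\in C(I,H^1(\mathbb R))\cap C^1(I,H^{-1}(\mathbb R))$, and $W$ solves the linearized equation $$iW_Z+W_{TT}+\rho\,(2|Q|^2W+Q^2\overline W)=0$$ in $H^{-1}(\mathbb R)$ for every $Z\in I$. Assume moreover that $|T|\,W(0)\in L^2(\mathbb R)$. Then $|T|\,W(Z)\in L^2(\mathbb R)$ for every $Z\in I$, and the function $Z\mapsto |T|\,W(Z,\cdot)$ belongs to $L^\infty(I,L^2(\mathbb R))$. Furthermore, with $h(Z)=\|T\,W(Z)\|_{L^2}^2$, the quantities $\sup_{Z\in I}\|W_T(Z)\|_{L^2}$ and $\sup_{Z\in I}\|Q(Z)\|_{L^\infty}^2$ are finite, and $$\sqrt{h(Z)}\;\le\;\bigl(\sqrt{h(0)}+1\bigr)\,e^{\widetilde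 C Z/2}-1\qquad\text{for every } Z\in I,$$ where $\widetilde C=2\max\bigl\{\,2\sup_{Z\in I}\|W_T(Z)\|_{L^2},\ |\rho|\sup_{Z\in I}\|Q(Z)\|_{L^\infty}^2\bigr\}$. -/

import Mathlib

open MeasureTheory Set
open scoped SchwartzMap ENNReal

namespace NLSE

noncomputable section

/-- The complex Hilbert space `L²(ℝ)`. -/
abbrev L2 : Type := Lp ℂ 2 (volume : Measure ℝ)

/-- `g ∈ L²(ℝ)` is the derivative of `f ∈ L²(ℝ)` in the sense of (tempered) distributions. -/
def HasWeakDeriv (f g : L2) : Prop :=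
  TemperedDistribution.derivCLM ℂ (f : 𝓢'(ℝ, ℂ)) = (g : 𝓢'(ℝ, ℂ))

theorem HasWeakDeriv.add {f g f' g' : L2} (hf : HasWeakDeriv f f') (hg : HasWeakDeriv g g') :
    HasWeakDeriv (f + g) (f' + g') := by
  unfold HasWeakDeriv at *
  simp only [← Lp.toTemperedDistributionCLM_apply, map_add] at *
  rw [hf, hg]

theorem HasWeakDeriv.smul (c : ℂ) {f f' : L2} (hf : HasWeakDeriv f f') :
    HasWeakDeriv (c • f) (c • f') := by
  unfold HasWeakDeriv at *
  simp only [← Lp.toTemperedDistributionCLM_apply, map_smul] at *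
  rw [hf]

theorem HasWeakDeriv.zero : HasWeakDeriv 0 0 := by
  unfold HasWeakDeriv
  simp only [← Lp.toTemperedDistributionCLM_apply, map_zero]

/-- The Sobolev space `H¹(ℝ)`: an element is a pair `(u, u_T)` of `L²` functions whose second entry
is the distributional derivative of the first (and hence is determined by it). The norm inherited
from the product, `max(‖u‖, ‖u_T‖)`, is equivalent to the usual one. -/
def sobolevH1 : Submodule ℂ (L2 × L2) where
  carrier := {p | HasWeakDeriv p.1 p.2}
  add_mem' h k := HasWeakDeriv.add h k
  zero_mem' := HasWeakDeriv.zero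
  smul_mem' c _ h := HasWeakDeriv.smul c h

/-- The Sobolev space `H²(ℝ)`: an element is a triple `(u, u_T, u_TT)` of `L²` functions, each
entry being the distributional derivative of the preceding one. The norm inherited from the
product, `max(‖u‖, ‖u_T‖, ‖u_TT‖)`, is equivalent to the usual one. -/
def sobolevH2 : Submodule ℂ (L2 × L2 × L2) where
  carrier := {p | HasWeakDeriv p.1 p.2.1 ∧ HasWeakDeriv p.2.1 p.2.2}
  add_mem' h k := ⟨HasWeakDeriv.add h.1 k.1, HasWeakDeriv.add h.2 k.2⟩
  zero_mem' := ⟨HasWeakDeriv.zero, HasWeakDeriv.zero⟩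
  smul_mem' c _ h := ⟨HasWeakDeriv.smul c h.1, HasWeakDeriv.smul c h.2⟩

/-- The type of elements of `H¹(ℝ)`, with the norm and linear structure of `sobolevH1`. -/
def H1 : Type := sobolevH1

instance : NormedAddCommGroup H1 := inferInstanceAs (NormedAddCommGroup sobolevH1)

instance : NormedSpace ℂ H1 := inferInstanceAs (NormedSpace ℂ sobolevH1)

/-- The type of elements of `H²(ℝ)`, with the norm and linear structure of `sobolevH2`. -/
def H2 : Type := sobolevH2

instance : NormedAddCommGroup H2 := inferInstanceAs (NormedAddCommGroup sobolevH2)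

instance : NormedSpace ℂ H2 := inferInstanceAs (NormedSpace ℂ sobolevH2)

/-- The inclusion `H¹(ℝ) → L²(ℝ)`: the function `u` underlying an element of `H¹(ℝ)`. -/
def H1.fn : H1 →L[ℂ] L2 := (ContinuousLinearMap.fst ℂ L2 L2).comp sobolevH1.subtypeL

/-- The derivative `H¹(ℝ) → L²(ℝ)`, `u ↦ u_T`. -/
def H1.dT : H1 →L[ℂ] L2 := (ContinuousLinearMap.snd ℂ L2 L2).comp sobolevH1.subtypeL

/-- The function underlying an element of `H²(ℝ)`. -/
def H2.fn (u : H2) : L2 := u.1.1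

/-- The derivative `u_T ∈ H¹(ℝ)` of `u ∈ H²(ℝ)`. -/
def H2.dT (u : H2) : H1 := Subtype.mk (u.1.2.1, u.1.2.2) u.2.2

/-- The space `H⁻¹(ℝ)`, the dual of `H¹(ℝ)`. -/
abbrev HNeg1 : Type := H1 →L[ℂ] ℂ

/-- The bilinear pairing `(f, g) ↦ ∫ f g` on `L²(ℝ)`. -/
def pairing : L2 →L[ℂ] L2 →L[ℂ] ℂ :=
  (ContinuousLinearMap.mul ℂ ℂ).lpPairing (volume : Measure ℝ) 2 2

theorem pairing_apply (f g : L2) : pairing f g = ∫ T, f T * g T := by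
  simp [pairing, ContinuousLinearMap.lpPairing_eq_integral]

/-- The inclusion `L²(ℝ) → H⁻¹(ℝ)`, `f ↦ (φ ↦ ∫ f φ)`. -/
def toHNeg1 : L2 →L[ℂ] HNeg1 :=
  ((ContinuousLinearMap.compL ℂ H1 L2 ℂ).flip H1.fn).comp pairing

/-- The distributional derivative `L²(ℝ) → H⁻¹(ℝ)`, `f ↦ (φ ↦ -∫ f φ_T)`. -/
def dTHNeg1 : L2 →L[ℂ] HNeg1 :=
  -((ContinuousLinearMap.compL ℂ H1 L2 ℂ).flip H1.dT).comp pairing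

theorem toHNeg1_apply (f : L2) (φ : H1) : toHNeg1 f φ = ∫ T, f T * φ.fn T := by
  rw [← pairing_apply]; rfl

theorem dTHNeg1_apply (f : L2) (φ : H1) : dTHNeg1 f φ = -∫ T, f T * φ.dT T := by
  rw [← pairing_apply]; rfl

/-- `Q` is an `H²` solution on `[0, L]` of the cubic nonlinear Schrödinger equation
`i Q_Z + Q_TT + ρ |Q|² Q = 0`: it lies in `C([0, L], H²(ℝ)) ∩ C¹([0, L], L²(ℝ))`, and the equation
holds in `L²(ℝ)` for every `Z ∈ [0, L]`. -/
def IsH2Solution (ρ L : ℝ) (Q : ℝ → H2) : Prop :=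
  ContinuousOn Q (Icc 0 L) ∧
  ∃ QZ : ℝ → L2, ContinuousOn QZ (Icc 0 L) ∧
    ∀ Z ∈ Icc 0 L,
      HasDerivWithinAt (fun Z' => (Q Z').fn) (QZ Z) (Icc 0 L) Z ∧
      ∀ᵐ T : ℝ, Complex.I * QZ Z T + (Q Z).dT.dT T
        + (ρ : ℂ) * ((‖(Q Z).fn T‖ ^ 2 : ℝ) : ℂ) * (Q Z).fn T = 0

/-- `W` is an `H¹` solution on `[0, L]` of the linearized equation
`i W_Z + W_TT + ρ (2 |Q|² W + Q² W̄) = 0`: it lies in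
`C([0, L], H¹(ℝ)) ∩ C¹([0, L], H⁻¹(ℝ))`, and the equation holds in `H⁻¹(ℝ)` for every
`Z ∈ [0, L]`. Here `N Z = 2 |Q|² W + Q² W̄`, which is required to lie in `L²(ℝ)`. -/
def IsLinearizedSolution (ρ L : ℝ) (Q : ℝ → H2) (W : ℝ → H1) : Prop :=
  ContinuousOn W (Icc 0 L) ∧
  ∃ (WZ : ℝ → HNeg1) (N : ℝ → L2), ContinuousOn WZ (Icc 0 L) ∧
    ∀ Z ∈ Icc 0 L,
      HasDerivWithinAt (fun Z' => toHNeg1 (W Z').fn) (WZ Z) (Icc 0 L) Z ∧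
      (∀ᵐ T : ℝ, N Z T = 2 * ((‖(Q Z).fn T‖ ^ 2 : ℝ) : ℂ) * (W Z).fn T
        + (Q Z).fn T ^ 2 * (starRingEnd ℂ) ((W Z).fn T)) ∧
      Complex.I • WZ Z + dTHNeg1 (W Z).dT + (ρ : ℂ) • toHNeg1 (N Z) = 0

end

end NLSE

namespace NLSE

/-! The linearized equation is the `T`-derivative of the original one, taken in `H⁻¹`. It makes
sense because `H¹(ℝ) ⊆ L^∞(ℝ)`: the cubic term lies in `H¹`, and its derivative is `2|Q|²W + Q²W̄`
(`HasWeakDeriv.exists_cubic`).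

Formally, the growth bound comes from pairing the equation with `T² W̄`. This need not lie in `H¹`,
so `T²` is replaced by a bounded weight `m = T²/(1+εT²)`, which satisfies `|m'| ≤ 2√m` uniformly in
`ε`. Since `W_Z` lies only in `H⁻¹`, the derivative of `h_ε = ∫ m|W|²` is obtained from the symmetry
of the form (`hasDerivWithinAt_re_pairing`). In `h_ε' = 2 Re⟨W_Z, m W̄⟩` the terms `m|W_T|²` and
`2ρ|Q|²m|W|²` carry a factor `i` and drop out (`re_weighted_flux_le`). With `A = sup ‖W_T‖` and `B =
sup ‖Q‖²_∞`, what remains gives `h_ε' ≤ 2(2A√h_ε + |ρ|B h_ε) ≤ 2M(√h_ε + h_ε)`, where `M = max(2A,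
|ρ|B)` is half of `C̃`. Grönwall for `√h_ε + 1` gives a bound uniform in `ε`, and Fatou's lemma lets
`ε → 0`. -/

open Filter Topology
open scoped ContDiff

/-! ### Locally absolutely continuous functions. -/

/-- `F` is a locally absolutely continuous function on `ℝ` with a.e. derivative `f`. -/
structure IsPrimitive (F f : ℝ → ℂ) : Prop where
  locallyIntegrable : LocallyIntegrable f
  sub_eq : ∀ a b, F b - F a = ∫ x in a..b, f x

theorem intervalIntegrable_of_locallyIntegrable {f : ℝ → ℂ}
    (hf : LocallyIntegrable f) (a b : ℝ) : IntervalIntegrable f volume a b :=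
  intervalIntegrable_iff.mpr <|
    (hf.integrableOn_isCompact isCompact_uIcc).mono_set uIoc_subset_uIcc

theorem IsPrimitive.integral {f : ℝ → ℂ} (hf : LocallyIntegrable f) (c : ℂ) :
    IsPrimitive (fun x => c + ∫ t in (0 : ℝ)..x, f t) f := by
  refine ⟨hf, fun a b => ?_⟩
  rw [add_sub_add_left_eq_sub, intervalIntegral.integral_interval_sub_left] <;>
  exact intervalIntegrable_of_locallyIntegrable hf _ _

namespace IsPrimitive

variable {F f G g : ℝ → ℂ}

theorem eq_add (hF : IsPrimitive F f) (a : ℝ) : F = fun x => F a + ∫ t in a..x, f t := by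
  ext x; rw [← hF.sub_eq]; ring

theorem continuous (hF : IsPrimitive F f) : Continuous F := by
  rw [hF.eq_add 0]
  exact continuous_const.add
    (intervalIntegral.continuous_primitive (fun a b => intervalIntegrable_of_locallyIntegrable hF.1 a b) 0)

theorem ae_hasDerivAt (hF : IsPrimitive F f) : ∀ᵐ x, HasDerivAt F (f x) x := by
  filter_upwards [LocallyIntegrable.ae_hasDerivAt_integral hF.1] with x hx
  rw [hF.eq_add 0]
  exact (hx 0).const_add _

theorem absolutelyContinuousOnInterval (hF : IsPrimitive F f) (a b : ℝ) :
    AbsolutelyContinuousOnInterval F a b := by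
  have hn : IntervalIntegrable (fun x => ‖f x‖) volume a b := (intervalIntegrable_of_locallyIntegrable hF.1 a b).norm
  have h := hn.absolutelyContinuousOnInterval_intervalIntegral (c := a) (by simp)
  have hint (x y : ℝ) : IntervalIntegrable (fun x => ‖f x‖) volume x y :=
    (intervalIntegrable_of_locallyIntegrable hF.1 x y).norm
  refine squeeze_zero (fun t => Finset.sum_nonneg fun i _ => dist_nonneg)
    (fun t => Finset.sum_le_sum fun i _ => ?_) h
  rw [dist_comm, dist_comm (∫ v in a..(t.2 i).1, ‖f v‖), dist_eq_norm, dist_eq_norm, hF.sub_eq,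
    intervalIntegral.integral_interval_sub_left (hint _ _) (hint _ _)]
  exact intervalIntegral.norm_integral_le_abs_integral_norm

/-- The difference of `F` and the integral of `f` is absolutely continuous with a.e. zero
derivative, hence constant. This reduces the product rule to an a.e. pointwise statement. -/
theorem of_absolutelyContinuousOnInterval
    (hF : ∀ a b, AbsolutelyContinuousOnInterval F a b) (hf : LocallyIntegrable f)
    (hd : ∀ᵐ x, HasDerivAt F (f x) x) : IsPrimitive F f := by
  refine ⟨hf, fun a b => ?_⟩
  have hG := IsPrimitive.integral hf 0
  have h0 : ∀ᵐ x, x ∈ uIcc a b → HasDerivAt (F - fun x => 0 + ∫ t in (0 : ℝ)..x, f t) 0 x := by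
    filter_upwards [hd, hG.ae_hasDerivAt] with x h1 h2 _
    simpa using h1.sub h2
  obtain ⟨C, hC⟩ := ((hF a b).sub (hG.absolutelyContinuousOnInterval a b)).const_of_ae_hasDerivAt_zero h0
  have h1 := hC a (by simp)
  have h2 := hC b (by simp)
  rw [← hG.sub_eq]
  simp only [Pi.sub_apply] at h1 h2
  linear_combination h2 - h1

theorem mul (hF : IsPrimitive F f) (hG : IsPrimitive G g) :
    IsPrimitive (fun x => F x * G x) (fun x => f x * G x + F x * g x) := by
  refine of_absolutelyContinuousOnInterval (fun a b =>
    (hF.absolutelyContinuousOnInterval a b).smul (hG.absolutelyContinuousOnInterval a b)) ?_ ?_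
  · refine LocallyIntegrable.add ?_ ?_
    · exact (locallyIntegrableOn_univ.1 ((locallyIntegrableOn_univ.2 hF.1).mul_continuousOn
        hG.continuous.continuousOn isClosed_univ.isLocallyClosed))
    · exact (locallyIntegrableOn_univ.1 ((locallyIntegrableOn_univ.2 hG.1).continuousOn_mul
        hF.continuous.continuousOn isClosed_univ.isLocallyClosed))
  · filter_upwards [hF.ae_hasDerivAt, hG.ae_hasDerivAt] with x h1 h2
    exact h1.mul h2

theorem of_hasDerivAt (hd : ∀ x, HasDerivAt F (f x) x) (hf : Continuous f) : IsPrimitive F f :=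
  ⟨hf.locallyIntegrable, fun a b => (intervalIntegral.integral_eq_sub_of_hasDerivAt
    (fun x _ => hd x) (hf.intervalIntegrable a b)).symm⟩

theorem conj (hF : IsPrimitive F f) :
    IsPrimitive (fun x => (starRingEnd ℂ) (F x)) (fun x => (starRingEnd ℂ) (f x)) := by
  refine ⟨fun x => ?_, fun a b => ?_⟩
  · obtain ⟨s, hs, h⟩ := hF.1 x
    exact ⟨s, hs, Complex.conjLIE.integrable_comp_iff.2 h⟩
  · rw [← map_sub, hF.sub_eq]
    exact ((Complex.conjCLE : ℂ →L[ℝ] ℂ).intervalIntegral_comp_comm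
      (intervalIntegrable_of_locallyIntegrable hF.1 a b)).symm

/-- Integrability of `f` gives `F` limits at `±∞`, integrability of `F` forces both to vanish, and
`∫ f` is their difference. -/
theorem integral_eq_zero (hF : IsPrimitive F f) (hFi : Integrable F) (hfi : Integrable f) :
    ∫ x, f x = 0 := by
  have hT : Tendsto F atTop (𝓝 (F 0 + ∫ x in Ioi (0 : ℝ), f x)) := by
    rw [hF.eq_add 0]
    simpa using tendsto_const_nhds.add
      (intervalIntegral_tendsto_integral_Ioi 0 hfi.integrableOn tendsto_id)
  have hB : Tendsto F atBot (𝓝 (F 0 - ∫ x in Iic (0 : ℝ), f x)) := by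
    have : F = fun x => F 0 - ∫ t in x..0, f t := by ext x; rw [← hF.sub_eq]; ring
    rw [this]
    simpa using tendsto_const_nhds.sub
      (intervalIntegral_tendsto_integral_Iic 0 hfi.integrableOn tendsto_id)
  have h1 := (hFi.integrableAtFilter atTop).eq_zero_of_tendsto (fun s hs => by
    obtain ⟨a, ha⟩ := mem_atTop_sets.1 hs
    exact measure_mono_top (fun x hx => ha x hx) (Real.volume_Ici (a := a))) hT
  have h2 := (hFi.integrableAtFilter atBot).eq_zero_of_tendsto (fun s hs => by
    obtain ⟨a, ha⟩ := mem_atBot_sets.1 hs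
    exact measure_mono_top (fun x hx => ha x hx) (Real.volume_Iic (a := a))) hB
  rw [← intervalIntegral.integral_Iic_add_Ioi hfi.integrableOn hfi.integrableOn]
  linear_combination h1 - h2

end IsPrimitive

/-! ### Weak derivatives in `L²`, integration by parts, Sobolev embedding. -/

/-- The lemma of du Bois-Reymond: a locally integrable function with vanishing distributional
derivative is a.e. constant. -/
theorem ae_eq_const_of_integral_deriv_eq_zero {u : ℝ → ℂ} (hu : LocallyIntegrable u)
    (h : ∀ φ : ℝ → ℝ, ContDiff ℝ ∞ φ → HasCompactSupport φ → ∫ x, deriv φ x • u x = 0) :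
    ∃ c : ℂ, ∀ᵐ x, u x = c := by
  obtain ⟨ψ, hψ, hψc, hψ1⟩ : ∃ ψ : ℝ → ℝ, ContDiff ℝ ∞ ψ ∧ HasCompactSupport ψ ∧
      ∫ x, ψ x = 1 := by
    let b : ContDiffBump (0 : ℝ) := ⟨1, 2, by norm_num, by norm_num⟩
    exact ⟨b.normed volume, b.contDiff_normed, b.hasCompactSupport_normed, b.integral_normed⟩
  refine ⟨∫ x, ψ x • u x, ?_⟩
  refine ae_eq_of_integral_contDiff_smul_eq hu (locallyIntegrable_const _) fun η hη hηc => ?_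
  -- A test function of mean zero is the derivative of a test function, namely of its integral from
  -- `-∞`.
  have key (θ : ℝ → ℝ) (hθ : ContDiff ℝ ∞ θ) (hθc : HasCompactSupport θ) (h0 : ∫ x, θ x = 0) :
      ∫ x, θ x • u x = 0 := by
    obtain ⟨R, hR⟩ : ∃ R : ℝ, ∀ x, R ≤ |x| → θ x = 0 := by
      obtain ⟨R, -, hR⟩ := hθc.isCompact.isBounded.subset_ball_lt 0 (0 : ℝ)
      refine ⟨R, fun x hx => image_eq_zero_of_notMem_tsupport fun hx' => ?_⟩
      have := hR hx'
      simp at this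
      linarith
    have hd (x : ℝ) : HasDerivAt (fun x => ∫ t in Iic x, θ t) (θ x) x := by
      have hi : Integrable θ := hθ.continuous.integrable_of_hasCompactSupport hθc
      have := (hθ.continuous.integral_hasStrictDerivAt 0 x).hasDerivAt.const_add
        (∫ t in Iic (0 : ℝ), θ t)
      refine this.congr_of_eventuallyEq (Eventually.of_forall fun y => ?_)
      show _ = (_ : ℝ) + _
      rw [← intervalIntegral.integral_Iic_sub_Iic hi.integrableOn hi.integrableOn]
      ring
    have hde : deriv (fun x => ∫ t in Iic x, θ t) = θ := funext fun x => (hd x).deriv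
    have := h (fun x => ∫ t in Iic x, θ t) ?_ ?_
    · rwa [hde] at this
    · rw [contDiff_infty_iff_deriv, hde]
      exact ⟨fun x => (hd x).differentiableAt, hθ⟩
    · refine HasCompactSupport.intro (isCompact_Icc (a := -R) (b := R)) fun x hx => ?_
      rw [mem_Icc, not_and_or, not_le, not_le] at hx
      have hi : Integrable θ := hθ.continuous.integrable_of_hasCompactSupport hθc
      rcases hx with hx | hx
      · refine setIntegral_eq_zero_of_forall_eq_zero fun t ht => hR t ?_
        rw [mem_Iic] at ht
        exact le_trans (by linarith) (neg_le_abs t)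
      · have := intervalIntegral.integral_Iic_add_Ioi (b := x) hi.integrableOn hi.integrableOn
        rw [h0, setIntegral_eq_zero_of_forall_eq_zero (t := Ioi x), add_zero] at this
        · exact this
        · intro t ht
          refine hR t ((le_of_lt (hx.trans ht)).trans (le_abs_self t))
  have hint (θ : ℝ → ℝ) (hθ : ContDiff ℝ ∞ θ) (hθc : HasCompactSupport θ) :
      Integrable (fun x => θ x • u x) := hu.integrable_smul_left_of_hasCompactSupport hθ.continuous hθc
  have hi : Integrable η := hη.continuous.integrable_of_hasCompactSupport hηc
  have hi' : Integrable ψ := hψ.continuous.integrable_of_hasCompactSupport hψc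
  -- Subtracting a multiple of the unit-mass bump `ψ` makes the mean of `η` zero.
  have := key (fun x => η x - (∫ y, η y) * ψ x) (hη.sub (contDiff_const.mul hψ))
    (hηc.sub (hψc.mul_left)) (by
      rw [integral_sub hi (hi'.const_mul _), integral_const_mul, hψ1]; ring)
  simp_rw [sub_smul, mul_smul] at this
  rw [integral_sub (hint η hη hηc) ((hint ψ hψ hψc).fun_smul _), integral_smul, sub_eq_zero] at this
  rw [this, integral_smul_const]

theorem integrable_mul_L2 (f g : L2) : Integrable (fun x => f x * g x) :=
  (Lp.memLp f).integrable_mul (Lp.memLp g)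

theorem locallyIntegrable_L2 (f : L2) : LocallyIntegrable f :=
  (Lp.memLp f).locallyIntegrable (by norm_num)

theorem hasWeakDeriv_iff {f g : L2} : HasWeakDeriv f g ↔
    ∀ φ : 𝓢(ℝ, ℂ), ∫ x, deriv φ x * f x = -∫ x, φ x * g x := by
  unfold HasWeakDeriv
  rw [DFunLike.ext_iff]
  refine forall_congr' fun φ => ?_
  rw [TemperedDistribution.derivCLM_apply_apply, map_neg, Lp.toTemperedDistribution_apply,
    Lp.toTemperedDistribution_apply]
  simp only [SchwartzMap.derivCLM_apply, smul_eq_mul]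
  exact neg_eq_iff_eq_neg

/-- By du Bois-Reymond, `f` minus a primitive of `g` is a.e. constant. The continuous representative
makes the classical product rule available. -/
theorem HasWeakDeriv.exists_isPrimitive {f g : L2} (h : HasWeakDeriv f g) :
    ∃ F : ℝ → ℂ, IsPrimitive F g ∧ f =ᵐ[volume] F := by
  have hP := IsPrimitive.integral (locallyIntegrable_L2 g) 0
  obtain ⟨c, hc⟩ := ae_eq_const_of_integral_deriv_eq_zero
    (u := fun x => f x - (0 + ∫ t in (0 : ℝ)..x, g t))
    ((locallyIntegrable_L2 f).sub hP.continuous.locallyIntegrable) (fun φ hφ hφc => by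
      have h1 : HasCompactSupport (Complex.ofRealCLM ∘ φ) := hφc.comp_left rfl
      have h2 : ContDiff ℝ ∞ (Complex.ofRealCLM ∘ φ) := by fun_prop
      have hd (x : ℝ) : HasDerivAt (Complex.ofRealCLM ∘ φ) ((deriv φ x : ℝ) : ℂ) x :=
        ((hφ.differentiable (by simp)) x).hasDerivAt.ofReal_comp
      have hdc : Continuous (deriv φ) := hφ.continuous_deriv (by simp)
      have h3 := hasWeakDeriv_iff.1 h (h1.toSchwartzMap h2)
      have hde : deriv (h1.toSchwartzMap h2) = fun x => ((deriv φ x : ℝ) : ℂ) :=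
        funext fun x => (hd x).deriv
      have hφP : IsPrimitive (Complex.ofRealCLM ∘ φ) (fun x => ((deriv φ x : ℝ) : ℂ)) :=
        .of_hasDerivAt hd (Complex.continuous_ofReal.comp hdc)
      have hi1 : Integrable (fun x => deriv φ x • (0 + ∫ t in (0 : ℝ)..x, g t)) :=
        hP.continuous.locallyIntegrable.integrable_smul_left_of_hasCompactSupport hdc hφc.deriv
      have hi2 : Integrable (fun x => φ x • g x) :=
        (locallyIntegrable_L2 g).integrable_smul_left_of_hasCompactSupport hφ.continuous hφc
      have hi3 : Integrable (fun x => φ x • (0 + ∫ t in (0 : ℝ)..x, g t)) :=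
        hP.continuous.locallyIntegrable.integrable_smul_left_of_hasCompactSupport hφ.continuous hφc
      have hi4 : Integrable (fun x => deriv φ x • f x) :=
        (locallyIntegrable_L2 f).integrable_smul_left_of_hasCompactSupport hdc hφc.deriv
      have h4 := (hφP.mul hP).integral_eq_zero hi3 (hi1.add hi2)
      have h5 : ∫ x, deriv φ x • f x = - ∫ x, φ x • g x := by
        simpa [hde] using h3
      have h6 : (∫ x, deriv φ x • (0 + ∫ t in (0 : ℝ)..x, g t)) + ∫ x, φ x • g x = 0 := by
        rw [← integral_add hi1 hi2]
        exact h4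
      simp_rw [smul_sub]
      rw [integral_sub hi4 hi1, h5]
      linear_combination -h6)
  refine ⟨_, IsPrimitive.integral (locallyIntegrable_L2 g) c, ?_⟩
  filter_upwards [hc] with x hx
  linear_combination hx

theorem IsPrimitive.integral_mul_eq {F G f' g' : ℝ → ℂ} {f g u v : L2}
    (hF : IsPrimitive F f') (hG : IsPrimitive G g') (hfF : f =ᵐ[volume] F) (hgf : g =ᵐ[volume] f')
    (huG : u =ᵐ[volume] G) (hvg : v =ᵐ[volume] g') :
    ∫ x, f x * v x = -∫ x, g x * u x := by
  have h1 : Integrable (fun x => F x * G x) := (integrable_mul_L2 f u).congr (by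
    filter_upwards [hfF, huG] with x h1 h2; rw [h1, h2])
  have h2 : (fun x => g x * u x + f x * v x) =ᵐ[volume] fun x => f' x * G x + F x * g' x := by
    filter_upwards [hfF, hgf, huG, hvg] with x h1 h2 h3 h4
    rw [h1, h2, h3, h4]
  have h3 := (hF.mul hG).integral_eq_zero h1
    (((integrable_mul_L2 g u).add (integrable_mul_L2 f v)).congr h2)
  rw [← integral_congr_ae h2, integral_add (integrable_mul_L2 g u) (integrable_mul_L2 f v)] at h3
  linear_combination h3

theorem IsPrimitive.hasWeakDeriv {F f' : ℝ → ℂ} {f g : L2}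
    (hF : IsPrimitive F f') (hfF : f =ᵐ[volume] F) (hgf : g =ᵐ[volume] f') : HasWeakDeriv f g := by
  refine hasWeakDeriv_iff.2 fun φ => ?_
  have h := IsPrimitive.integral_mul_eq (u := φ.toLp 2) (v := (SchwartzMap.derivCLM ℂ ℂ φ).toLp 2)
    hF (IsPrimitive.of_hasDerivAt (f := deriv φ) (fun x => φ.differentiableAt.hasDerivAt)
      (SchwartzMap.derivCLM ℂ ℂ φ).continuous) hfF hgf (φ.coeFn_toLp 2)
    ((SchwartzMap.derivCLM ℂ ℂ φ).coeFn_toLp 2)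
  have e1 : ∫ x, f x * (SchwartzMap.derivCLM ℂ ℂ φ).toLp 2 volume x = ∫ x, deriv φ x * f x := by
    refine integral_congr_ae ?_
    filter_upwards [(SchwartzMap.derivCLM ℂ ℂ φ).coeFn_toLp 2 volume] with x hx
    rw [hx, SchwartzMap.derivCLM_apply, mul_comm]
  have e2 : ∫ x, g x * φ.toLp 2 volume x = ∫ x, φ x * g x := by
    refine integral_congr_ae ?_
    filter_upwards [φ.coeFn_toLp 2 volume] with x hx
    rw [hx, mul_comm]
  rw [← e1, h, e2]

theorem HasWeakDeriv.integral_mul_eq {f g u v : L2} (h : HasWeakDeriv f g)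
    (h' : HasWeakDeriv u v) : ∫ x, f x * v x = -∫ x, g x * u x := by
  obtain ⟨F, hF, hfF⟩ := h.exists_isPrimitive
  obtain ⟨G, hG, huG⟩ := h'.exists_isPrimitive
  exact hF.integral_mul_eq hG hfF ae_eq_rfl huG ae_eq_rfl

/-- Hölder on an interval of length one, so the constant is `1`. -/
theorem intervalIntegral_norm_le_L2 (f : L2) (x : ℝ) : ∫ t in x..(x + 1), ‖f t‖ ≤ ‖f‖ := by
  rw [intervalIntegral.integral_of_le (by linarith)]
  have h2 : MemLp f 2 (volume.restrict (Ioc x (x + 1))) := (Lp.memLp f).restrict _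
  have h1 : MemLp f 1 (volume.restrict (Ioc x (x + 1))) := h2.mono_exponent (by norm_num)
  rw [integral_norm_eq_lintegral_enorm h1.1, ← eLpNorm_one_eq_lintegral_enorm, Lp.norm_def]
  refine ENNReal.toReal_mono (Lp.eLpNorm_ne_top f) ?_
  refine (eLpNorm_le_eLpNorm_mul_rpow_measure_univ (p := 1) (q := 2) (by norm_num) h1.1).trans ?_
  simp only [Measure.restrict_apply, MeasurableSet.univ, univ_inter, Real.volume_Ioc,
    add_sub_cancel_left, ENNReal.ofReal_one, ENNReal.one_rpow, mul_one]
  exact eLpNorm_mono_measure _ Measure.restrict_le_self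

/-- The one-dimensional Sobolev embedding `H¹(ℝ) ⊆ L^∞(ℝ)`. -/
theorem IsPrimitive.norm_le {F : ℝ → ℂ} {f g : L2} (hF : IsPrimitive F g) (hfF : f =ᵐ[volume] F)
    (x : ℝ) : ‖F x‖ ≤ ‖f‖ + ‖g‖ := by
  have hi (h : L2) (a b : ℝ) : IntervalIntegrable (fun t => ‖h t‖) volume a b :=
    (intervalIntegrable_of_locallyIntegrable (locallyIntegrable_L2 h) a b).norm
  -- The bound at `x` by the value at each `a` is then averaged over `a ∈ [x, x + 1]`.
  have h1 (a : ℝ) (ha : a ∈ Icc x (x + 1)) : ‖F x‖ ≤ ‖F a‖ + ‖g‖ := by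
    have : ‖F a - F x‖ ≤ ‖g‖ := by
      rw [hF.sub_eq]
      refine (intervalIntegral.norm_integral_le_integral_norm ha.1).trans
        (le_trans ?_ (intervalIntegral_norm_le_L2 g x))
      exact intervalIntegral.integral_mono_interval le_rfl ha.1 ha.2
        (Eventually.of_forall fun t => norm_nonneg _) (hi g _ _)
    have h3 : ‖F x‖ ≤ ‖F a‖ + ‖F a - F x‖ := by
      have := norm_sub_le (F a) (F a - F x)
      simpa using this
    linarith
  have h2 : ∫ a in x..(x + 1), ‖F x‖ ≤ ∫ a in x..(x + 1), (‖F a‖ + ‖g‖) :=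
    intervalIntegral.integral_mono_on (by linarith) (by simp)
      ((hF.continuous.norm.add continuous_const).intervalIntegrable _ _) h1
  rw [intervalIntegral.integral_add (hF.continuous.norm.intervalIntegrable _ _) (by simp)] at h2
  have h3 : ∫ a in x..(x + 1), ‖F a‖ = ∫ a in x..(x + 1), ‖f a‖ :=
    intervalIntegral.integral_congr_ae (by filter_upwards [hfF] with t ht _; rw [ht])
  have := intervalIntegral_norm_le_L2 f x
  simp [h3] at h2
  linarith

theorem HasWeakDeriv.ae_norm_le {f g : L2} (h : HasWeakDeriv f g) : ∀ᵐ x, ‖f x‖ ≤ ‖f‖ + ‖g‖ := by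
  obtain ⟨F, hF, hfF⟩ := h.exists_isPrimitive
  filter_upwards [hfF] with x hx
  rw [hx]
  exact hF.norm_le hfF x

theorem HasWeakDeriv.toHNeg1_eq {f g : L2} (h : HasWeakDeriv f g) : toHNeg1 g = dTHNeg1 f := by
  ext φ
  rw [toHNeg1_apply, dTHNeg1_apply, eq_comm, neg_eq_iff_eq_neg]
  exact h.integral_mul_eq φ.2

/-! ### The nonlinearity and the linearized equation. -/

/-- The function `|f|² f` belongs to `H¹(ℝ)` if `f` does. -/
theorem HasWeakDeriv.exists_cubic {f w : L2} (h : HasWeakDeriv f w) :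
    ∃ c n : L2, HasWeakDeriv c n ∧
      (∀ᵐ T : ℝ, c T = ((‖f T‖ ^ 2 : ℝ) : ℂ) * f T) ∧
      (∀ᵐ T : ℝ, n T = 2 * ((‖f T‖ ^ 2 : ℝ) : ℂ) * w T + f T ^ 2 * (starRingEnd ℂ) (w T)) := by
  obtain ⟨F, hF, hfF⟩ := h.exists_isPrimitive
  set K := ‖f‖ + ‖w‖
  have hK : 0 ≤ K := by positivity
  have hb := h.ae_norm_le
  have hfm := Lp.aestronglyMeasurable f
  have hwm := Lp.aestronglyMeasurable w
  have hnm : AEStronglyMeasurable (fun T => ((‖f T‖ ^ 2 : ℝ) : ℂ)) volume :=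
    Complex.continuous_ofReal.comp_aestronglyMeasurable (hfm.norm.pow 2)
  have hcm : AEStronglyMeasurable (fun T => (starRingEnd ℂ) (w T)) volume :=
    Complex.continuous_conj.comp_aestronglyMeasurable hwm
  have hc : MemLp (fun T => ((‖f T‖ ^ 2 : ℝ) : ℂ) * f T) 2 := by
    refine (Lp.memLp f).of_le_mul (c := K ^ 2) (hnm.mul hfm) ?_
    filter_upwards [hb] with T hT
    rw [norm_mul, Complex.norm_real, norm_pow, norm_norm]
    gcongr
  have hn : MemLp (fun T => 2 * ((‖f T‖ ^ 2 : ℝ) : ℂ) * w T + f T ^ 2 * (starRingEnd ℂ) (w T)) 2 := by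
    refine (Lp.memLp w).of_le_mul (c := 3 * K ^ 2)
      (((hnm.const_mul 2).mul hwm).add ((hfm.pow 2).mul hcm)) ?_
    filter_upwards [hb] with T hT
    have h2 : ‖f T‖ ^ 2 ≤ K ^ 2 := by gcongr
    refine (norm_add_le _ _).trans ?_
    rw [norm_mul, norm_mul, norm_mul, Complex.norm_real, norm_pow, norm_norm, norm_pow,
      RCLike.norm_conj, Complex.norm_ofNat]
    nlinarith [norm_nonneg (w T)]
  refine ⟨hc.toLp _, hn.toLp _, ?_, hc.coeFn_toLp, hn.coeFn_toLp⟩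
  refine ((hF.mul hF.conj).mul hF).hasWeakDeriv ?_ ?_
  · filter_upwards [hc.coeFn_toLp, hfF] with T h1 h2
    rw [h1, h2, Complex.mul_conj, Complex.normSq_eq_norm_sq]
  · filter_upwards [hn.coeFn_toLp, hfF] with T h1 h2
    rw [h1, h2, ← Complex.normSq_eq_norm_sq, ← Complex.mul_conj]
    ring

theorem continuous_H2_dT : Continuous H2.dT :=
  Continuous.subtype_mk (((continuous_fst.comp continuous_snd).prodMk
    (continuous_snd.comp continuous_snd)).comp continuous_subtype_val) _

/-- The continuous linear map `dTHNeg1 : L² → H⁻¹` is applied to the equation and to the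
`Z`-derivative of `Q`, so `W_Z = ∂_T Q_Z`. -/
theorem IsH2Solution.isLinearizedSolution {ρ L : ℝ} {Q : ℝ → H2} (hQ : IsH2Solution ρ L Q)
    {W : ℝ → H1} (hW : ∀ Z ∈ Icc 0 L, W Z = (Q Z).dT) : IsLinearizedSolution ρ L Q W := by
  obtain ⟨hQc, QZ, hQZ, h⟩ := hQ
  choose c n hcn hc hn using fun Z => HasWeakDeriv.exists_cubic (f := (Q Z).fn)
    (w := (Q Z).dT.fn) (Q Z).2.1
  refine ⟨(continuous_H2_dT.comp_continuousOn hQc).congr hW, fun Z => dTHNeg1 (QZ Z), n,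
    dTHNeg1.continuous.comp_continuousOn hQZ, fun Z hZ => ⟨?_, ?_, ?_⟩⟩
  · have hd := (dTHNeg1.restrictScalars ℝ).hasFDerivAt.comp_hasDerivWithinAt Z (h Z hZ).1
    have he (Z') (hZ' : Z' ∈ Icc 0 L) : toHNeg1 (W Z').fn = dTHNeg1 (Q Z').fn := by
      rw [hW Z' hZ']
      exact HasWeakDeriv.toHNeg1_eq (Q Z').2.1
    exact hd.congr he (he Z hZ)
  · rw [hW Z hZ]; exact hn Z
  · have he : Complex.I • QZ Z + (Q Z).dT.dT + (ρ : ℂ) • c Z = 0 := by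
      refine Lp.ext ?_
      filter_upwards [(h Z hZ).2, hc Z, Lp.coeFn_add (Complex.I • QZ Z + (Q Z).dT.dT) ((ρ : ℂ) • c Z),
        Lp.coeFn_add (Complex.I • QZ Z) (Q Z).dT.dT, Lp.coeFn_smul Complex.I (QZ Z),
        Lp.coeFn_smul (ρ : ℂ) (c Z), Lp.coeFn_zero ℂ 2 (volume : Measure ℝ)]
        with T h1 h2 h3 h4 h5 h6 h7
      rw [h3, h7, Pi.add_apply, h4, Pi.add_apply, h5, h6, Pi.smul_apply, Pi.smul_apply, h2,
        smul_eq_mul, smul_eq_mul, ← mul_assoc]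
      exact h1
    rw [hW Z hZ, (hcn Z).toHNeg1_eq, ← map_smul, ← map_smul, ← map_add, ← map_add, he, map_zero]

/-! ### Norms and multiplication operators on `L²` and `H¹`. -/

theorem sq_norm_L2 (f : L2) : ‖f‖ ^ 2 = ∫ x, ‖f x‖ ^ 2 := by
  have h := inner_self_eq_norm_sq_to_K (𝕜 := ℂ) f
  rw [L2.inner_def] at h
  have h2 : ∫ x, inner ℂ (f x) (f x) = ((∫ x, ‖f x‖ ^ 2 : ℝ) : ℂ) := by
    rw [← integral_complex_ofReal]
    refine integral_congr_ae (Eventually.of_forall fun x => ?_)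
    simp only [inner_self_eq_norm_sq_to_K]
    norm_cast
  rw [h2] at h
  exact Complex.ofReal_injective (by simpa using h.symm)

theorem integrable_sq_norm_L2 (f : L2) : Integrable (fun x => ‖f x‖ ^ 2) :=
  (Lp.memLp f).integrable_norm_pow (by norm_num)

theorem integrable_norm_mul_norm_L2 (f g : L2) : Integrable (fun x => ‖f x‖ * ‖g x‖) :=
  (Lp.memLp f).norm.integrable_mul (Lp.memLp g).norm

/-- The Cauchy-Schwarz inequality. -/
theorem integral_norm_mul_norm_le (f g : L2) : ∫ x, ‖f x‖ * ‖g x‖ ≤ ‖f‖ * ‖g‖ := by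
  have h := integral_mul_norm_le_Lp_mul_Lq (μ := (volume : Measure ℝ)) (f := f) (g := g)
    (Real.HolderConjugate.two_two) (by simpa using Lp.memLp f) (by simpa using Lp.memLp g)
  have e (u : L2) : (∫ x, ‖u x‖ ^ (2 : ℝ)) ^ (1 / 2 : ℝ) = ‖u‖ := by
    simp only [Real.rpow_two]
    rw [← sq_norm_L2, ← Real.sqrt_eq_rpow, Real.sqrt_sq (norm_nonneg _)]
  rwa [e, e] at h

/-- Multiplication by a bounded function on `L²(ℝ)`. -/
noncomputable def mulL (g : ℝ → ℂ) (hg : MemLp g ∞ volume) : L2 →L[ℂ] L2 :=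
  (ContinuousLinearMap.mul ℂ ℂ).holderL volume ∞ 2 2 (hg.toLp g)

theorem mulL_ae (g : ℝ → ℂ) (hg : MemLp g ∞ volume) (f : L2) :
    mulL g hg f =ᵐ[volume] fun x => g x * f x := by
  filter_upwards [(ContinuousLinearMap.mul ℂ ℂ).coeFn_holder (r := 2) (hg.toLp g) f, hg.coeFn_toLp]
    with x h1 h2
  rw [← h2]
  exact h1

/-- Complex conjugation on `L²(ℝ)`. -/
noncomputable def conjL : L2 →L[ℝ] L2 := (Complex.conjCLE : ℂ →L[ℝ] ℂ).compLpL 2 volume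

theorem conjL_ae (f : L2) : conjL f =ᵐ[volume] fun x => (starRingEnd ℂ) (f x) :=
  (Complex.conjCLE : ℂ →L[ℝ] ℂ).coeFn_compLpL f

/-- The antilinear operator `u ↦ m ū` on `H¹(ℝ)`, for a bounded real `m` with bounded derivative. -/
theorem exists_conjMul {m m' : ℝ → ℝ} {C : ℝ} (hm : ∀ x, HasDerivAt m (m' x) x)
    (hm' : Continuous m') (hC : ∀ x, |m x| ≤ C) (hC' : ∀ x, |m' x| ≤ C) :
    ∃ R : H1 → H1, Continuous R ∧ ∀ u : H1,
      (∀ᵐ x, (R u).fn x = m x * (starRingEnd ℂ) (u.fn x)) ∧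
      (∀ᵐ x, (R u).dT x = m' x * (starRingEnd ℂ) (u.fn x) + m x * (starRingEnd ℂ) (u.dT x)) := by
  have hmc : Continuous m := continuous_iff_continuousAt.2 fun x => (hm x).continuousAt
  have hb {g : ℝ → ℝ} (hg : Continuous g) (hC : ∀ x, |g x| ≤ C) :
      MemLp (fun x => (g x : ℂ)) ∞ volume :=
    memLp_top_of_bound (Complex.continuous_ofReal.comp hg).aestronglyMeasurable C
      (Eventually.of_forall fun x => by simpa using hC x)
  set M := mulL _ (hb hmc hC)
  set M' := mulL _ (hb hm' hC')
  have h0 (u : H1) : ∀ᵐ x, M (conjL u.fn) x = m x * (starRingEnd ℂ) (u.fn x) := by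
    filter_upwards [mulL_ae _ (hb hmc hC) (conjL u.fn), conjL_ae u.fn] with x h1 h2
    rw [h1, h2]
  have h0' (u : H1) : ∀ᵐ x, (M' (conjL u.fn) + M (conjL u.dT)) x =
      m' x * (starRingEnd ℂ) (u.fn x) + m x * (starRingEnd ℂ) (u.dT x) := by
    filter_upwards [mulL_ae _ (hb hmc hC) (conjL u.dT), conjL_ae u.fn,
      mulL_ae _ (hb hm' hC') (conjL u.fn), conjL_ae u.dT,
      Lp.coeFn_add (M' (conjL u.fn)) (M (conjL u.dT))] with x h1 h2 h3 h4 h5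
    rw [h5, Pi.add_apply, h1, h3, h2, h4]
  have hW (u : H1) : HasWeakDeriv (M (conjL u.fn)) (M' (conjL u.fn) + M (conjL u.dT)) := by
    obtain ⟨F, hF, hfF⟩ := HasWeakDeriv.exists_isPrimitive (f := u.fn) (g := u.dT) u.2
    refine ((IsPrimitive.of_hasDerivAt (fun x => (hm x).ofReal_comp)
      (Complex.continuous_ofReal.comp hm')).mul hF.conj).hasWeakDeriv ?_ ?_
    · filter_upwards [h0 u, hfF] with x h1 h2
      rw [h1, h2]
    · filter_upwards [h0' u, hfF] with x h1 h2
      rw [h1, h2]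
  refine ⟨fun u => Subtype.mk (M (conjL u.fn), M' (conjL u.fn) + M (conjL u.dT)) (hW u), ?_,
    fun u => ⟨h0 u, h0' u⟩⟩
  have c1 : Continuous fun u : H1 => conjL u.fn := conjL.continuous.comp H1.fn.continuous
  have c2 : Continuous fun u : H1 => conjL u.dT := conjL.continuous.comp H1.dT.continuous
  exact Continuous.subtype_mk ((M.continuous.comp c1).prodMk
    ((M'.continuous.comp c1).add (M.continuous.comp c2))) _

/-! ### Differentiating the quadratic form, and Grönwall. -/

/-- The derivative of a symmetric pairing between a differentiable curve in `H⁻¹(ℝ)` and a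
continuous curve in `H¹(ℝ)`. -/
theorem hasDerivWithinAt_re_pairing {s : Set ℝ} {l : ℝ → HNeg1} {l' : HNeg1} {r : ℝ → H1} {Z : ℝ}
    (hl : HasDerivWithinAt l l' s Z) (hr : ContinuousWithinAt r s Z)
    (hsymm : ∀ z ∈ s, (l z (r Z)).re = (l Z (r z)).re) :
    HasDerivWithinAt (fun z => (l z (r z)).re) (2 * (l' (r Z)).re) s Z := by
  rw [hasDerivWithinAt_iff_tendsto_slope] at hl ⊢
  -- By symmetry the cross terms cancel in the real part of `(l z - l Z)(r z + r Z)`, leaving the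
  -- increment of the form. Hence `r` only needs to be continuous.
  have h1 : Tendsto (fun z => (slope l Z z (r z + r Z)).re) (𝓝[s \ {Z}] Z)
      (𝓝 (l' (r Z + r Z)).re) :=
    (Complex.continuous_re.tendsto _).comp
      ((isBoundedBilinearMap_apply.continuous.tendsto (l', r Z + r Z)).comp
        (hl.prodMk_nhds ((hr.mono_left (nhdsWithin_mono _ sdiff_subset)).add tendsto_const_nhds)))
  have h2 : (l' (r Z + r Z)).re = 2 * (l' (r Z)).re := by
    rw [map_add, Complex.add_re]; ring
  rw [h2] at h1
  refine h1.congr' ?_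
  filter_upwards [self_mem_nhdsWithin] with z hz
  have := hsymm z hz.1
  rw [slope_def_module, slope_def_module]
  simp only [smul_apply, sub_apply, map_add, Complex.smul_re,
    Complex.add_re, Complex.sub_re, smul_eq_mul]
  rw [this]
  ring

/-- A Grönwall estimate for `h' ≤ 2 M (√h + h)`. -/
theorem sqrt_le_of_deriv_le {L M : ℝ} (hM : 0 ≤ M) {h h' : ℝ → ℝ}
    (hd : ∀ Z ∈ Icc 0 L, HasDerivWithinAt h (h' Z) (Icc 0 L) Z) (h0 : ∀ Z, 0 ≤ h Z)
    (hle : ∀ Z ∈ Icc 0 L, h' Z ≤ 2 * M * (√(h Z) + h Z)) {Z : ℝ} (hZ : Z ∈ Icc 0 L) :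
    √(h Z) ≤ (√(h 0) + 1) * Real.exp (M * Z) - 1 := by
  -- The shift by `δ` keeps the square root differentiable where `h` vanishes; `δ → 0` at the end.
  have key (δ : ℝ) (hδ : 0 < δ) :
      (√(h Z + δ) + 1) ≤ (√(h 0 + δ) + 1) * Real.exp (M * Z) := by
    have hp (z : ℝ) : 0 < h z + δ := by linarith [h0 z]
    have hanti : AntitoneOn (fun z => (√(h z + δ) + 1) * Real.exp (-M * z)) (Icc 0 L) := by
      have hD (z) (hz : z ∈ Icc 0 L) :
          HasDerivWithinAt (fun z => (√(h z + δ) + 1) * Real.exp (-M * z))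
            ((h' z / (2 * √(h z + δ))) * Real.exp (-M * z) +
              (√(h z + δ) + 1) * (Real.exp (-M * z) * (-M))) (Icc 0 L) z := by
        refine ((((hd z hz).add_const δ).sqrt (hp z).ne').add_const 1).mul ?_
        have := ((hasDerivAt_id z).const_mul (-M)).exp
        simpa using this.hasDerivWithinAt
      refine antitoneOn_of_hasDerivWithinAt_nonpos (convex_Icc 0 L)
        (fun z hz => (hD z hz).continuousWithinAt)
        (fun z hz => (hD z (interior_subset hz)).mono interior_subset) fun z hz => ?_
      have hz := interior_subset hz
      have hs := Real.sqrt_pos.2 (hp z)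
      -- With `s = √(h + δ)`, the hypothesis gives `h' ≤ 2M(√h + h) ≤ 2M s(1 + s)`; dividing by `2s`
      -- leaves `M(s + 1)`.
      have h1 : h' z / (2 * √(h z + δ)) ≤ M * (√(h z + δ) + 1) := by
        rw [div_le_iff₀ (by positivity)]
        have h2 : √(h z) ≤ √(h z + δ) := Real.sqrt_le_sqrt (by linarith)
        have h3 := Real.sq_sqrt (hp z).le
        have h4 : √(h z) + h z ≤ (√(h z + δ) + 1) * √(h z + δ) := by nlinarith
        have := hle z hz
        nlinarith [mul_le_mul_of_nonneg_left h4 hM]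
      have he := Real.exp_pos (-M * z)
      nlinarith
    have := hanti (left_mem_Icc.2 (hZ.1.trans hZ.2)) hZ hZ.1
    simp only [mul_zero, Real.exp_zero, mul_one] at this
    rw [neg_mul, Real.exp_neg, ← div_eq_mul_inv, div_le_iff₀ (Real.exp_pos _)] at this
    exact this
  have hl : Tendsto (fun δ => √(h Z + δ) + 1) (𝓝[>] 0) (𝓝 (√(h Z + 0) + 1)) :=
    Tendsto.mono_left (Continuous.tendsto (by fun_prop) 0) nhdsWithin_le_nhds
  have hr : Tendsto (fun δ => (√(h 0 + δ) + 1) * Real.exp (M * Z)) (𝓝[>] 0)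
      (𝓝 ((√(h 0 + 0) + 1) * Real.exp (M * Z))) :=
    Tendsto.mono_left (Continuous.tendsto (by fun_prop) 0) nhdsWithin_le_nhds
  have := le_of_tendsto_of_tendsto hl hr (by
    filter_upwards [self_mem_nhdsWithin] with δ hδ using key δ hδ)
  simp only [add_zero] at this
  linarith

/-! ### The regularized weight. -/

/-- The bounded weight `T² / (1 + ε T²)`, which approximates `T²`. -/
noncomputable def weight (ε T : ℝ) : ℝ := T ^ 2 / (1 + ε * T ^ 2)

section weight

variable {ε : ℝ} (hε : 0 < ε) (T : ℝ)
include hε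

theorem weight_nonneg : 0 ≤ weight ε T := by unfold weight; positivity

theorem weight_le_sq : weight ε T ≤ T ^ 2 :=
  div_le_self (sq_nonneg T) (by nlinarith [mul_nonneg hε.le (sq_nonneg T)])

theorem weight_le_inv : weight ε T ≤ 1 / ε := by
  unfold weight
  rw [div_le_div_iff₀ (by positivity) hε]
  linarith

theorem hasDerivAt_weight : HasDerivAt (weight ε) (2 * T / (1 + ε * T ^ 2) ^ 2) T := by
  have hp : 1 + ε * T ^ 2 ≠ 0 := by positivity
  have h1 : HasDerivAt (fun T : ℝ => T ^ 2) (2 * T) T := by simpa using hasDerivAt_pow 2 T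
  convert! h1.div ((h1.const_mul ε).const_add 1) hp using 1
  congr 1
  ring

/-- With `p = 1 + εT² ≥ 1`, the square of `T/p²` is `T²/p⁴ ≤ T²/p`. The constant `2` does not depend
on `ε`, so neither does the final estimate. -/
theorem abs_deriv_weight_le : |2 * T / (1 + ε * T ^ 2) ^ 2| ≤ 2 * √(weight ε T) := by
  have h1 : 1 ≤ 1 + ε * T ^ 2 := by nlinarith [mul_nonneg hε.le (sq_nonneg T)]
  have : |T / (1 + ε * T ^ 2) ^ 2| ≤ √(weight ε T) := by
    refine Real.abs_le_sqrt ?_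
    unfold weight
    rw [div_pow, ← pow_mul]
    gcongr
    exact le_self_pow₀ h1 (by norm_num)
  rw [mul_div_assoc, abs_mul, abs_two]
  gcongr

theorem continuous_weight : Continuous (weight ε) :=
  continuous_iff_continuousAt.2 fun x => (hasDerivAt_weight hε x).continuousAt

theorem memLp_sqrt_weight : MemLp (fun T => ((√(weight ε T) : ℝ) : ℂ)) ∞ volume :=
  memLp_top_of_bound (Complex.continuous_ofReal.comp
    (continuous_weight hε).sqrt).aestronglyMeasurable (√(1 / ε))
    (Eventually.of_forall fun x => by
      rw [Complex.norm_real, Real.norm_of_nonneg (Real.sqrt_nonneg _)]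
      exact Real.sqrt_le_sqrt (weight_le_inv hε x))

end weight

theorem tendsto_sqrt_weight (T : ℝ) :
    Tendsto (fun n : ℕ => √(weight (1 / ((n : ℝ) + 1)) T)) atTop (𝓝 |T|) := by
  have : Tendsto (fun n : ℕ => √(weight (1 / ((n : ℝ) + 1)) T)) atTop
      (𝓝 √(T ^ 2 / (1 + 0 * T ^ 2))) :=
    (tendsto_const_nhds.div (tendsto_const_nhds.add
      (tendsto_one_div_add_atTop_nhds_zero_nat.mul_const _)) (by simp)).sqrt
  simpa [Real.sqrt_sq_eq_abs] using this

/-! ### The weighted energy estimate. -/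

/-- Pointwise form of the energy estimate, with `a = W_T`, `b = W`, `q = Q`, `v = √m W` and test
function `r = m W̄`. -/
theorem re_weighted_flux_le {a b q n r r' v : ℂ} {m m' ρ B : ℝ} (hm : 0 ≤ m)
    (hm' : |m'| ≤ 2 * √m) (hB : ‖q‖ ^ 2 ≤ B)
    (hn : n = 2 * ((‖q‖ ^ 2 : ℝ) : ℂ) * b + q ^ 2 * (starRingEnd ℂ) b)
    (hr : r = m * (starRingEnd ℂ) b)
    (hr' : r' = m' * (starRingEnd ℂ) b + m * (starRingEnd ℂ) a)
    (hv : v = (√m : ℝ) * b) :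
    (Complex.I * (-(a * r') + ρ * (n * r))).re ≤ 2 * (‖a‖ * ‖v‖) + |ρ| * B * ‖v‖ ^ 2 := by
  have hvn : ‖v‖ = √m * ‖b‖ := by
    rw [hv, norm_mul, Complex.norm_real, Real.norm_of_nonneg (Real.sqrt_nonneg m)]
  have hv2 : ‖v‖ ^ 2 = m * ‖b‖ ^ 2 := by rw [hvn, mul_pow, Real.sq_sqrt hm]
  -- The first summand is purely imaginary. It absorbs the term `2|Q|²W` of the nonlinearity, which
  -- is why the constant is `|ρ|B` rather than `3|ρ|B`.
  have e : Complex.I * (-(a * r') + ρ * (n * r)) =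
      Complex.I * ((-(m * Complex.normSq a) + ρ * (2 * ‖q‖ ^ 2 * m * Complex.normSq b) : ℝ) : ℂ)
      + (-(Complex.I * m' * a * (starRingEnd ℂ) b)
        + ρ * m * Complex.I * q ^ 2 * (starRingEnd ℂ) b ^ 2) := by
    push_cast
    rw [← Complex.mul_conj, ← Complex.mul_conj, hn, hr, hr']
    push_cast
    ring
  rw [e, Complex.add_re, Complex.re_mul_ofReal, Complex.I_re, zero_mul, zero_add]
  refine (Complex.re_le_norm _).trans ((norm_add_le _ _).trans (add_le_add ?_ ?_))
  · rw [norm_neg, norm_mul, norm_mul, norm_mul, Complex.norm_I, Complex.norm_real, RCLike.norm_conj,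
      one_mul, hvn, Real.norm_eq_abs]
    calc |m'| * ‖a‖ * ‖b‖ ≤ 2 * √m * ‖a‖ * ‖b‖ := by gcongr
      _ = _ := by ring
  · rw [norm_mul, norm_mul, norm_mul, norm_mul, norm_pow, norm_pow, Complex.norm_I,
      Complex.norm_real, Complex.norm_real, RCLike.norm_conj, Real.norm_eq_abs,
      Real.norm_of_nonneg hm, hv2]
    calc |ρ| * m * 1 * ‖q‖ ^ 2 * ‖b‖ ^ 2 ≤ |ρ| * m * 1 * B * ‖b‖ ^ 2 := by gcongr
      _ = _ := by ring

/-- Solving the equation for `W_Z` and testing with `m W̄` turns the pairing into the integral of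
the pointwise flux; Cauchy-Schwarz handles the term in `W_T`. -/
theorem re_pairing_le {ρ A B ε : ℝ} (hε : 0 < ε) {u r : H1} {l' : HNeg1} {q n v : L2}
    (hA : ‖u.dT‖ ≤ A) (hB : ∀ᵐ T, ‖q T‖ ^ 2 ≤ B)
    (hn : ∀ᵐ T : ℝ, n T = 2 * ((‖q T‖ ^ 2 : ℝ) : ℂ) * u.fn T
        + q T ^ 2 * (starRingEnd ℂ) (u.fn T))
    (heq : Complex.I • l' + dTHNeg1 u.dT + (ρ : ℂ) • toHNeg1 n = 0)
    (hr : ∀ᵐ T, r.fn T = weight ε T * (starRingEnd ℂ) (u.fn T))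
    (hr' : ∀ᵐ T, r.dT T = ((2 * T / (1 + ε * T ^ 2) ^ 2 : ℝ) : ℂ) * (starRingEnd ℂ) (u.fn T)
      + weight ε T * (starRingEnd ℂ) (u.dT T))
    (hv : ∀ᵐ T, v T = (√(weight ε T) : ℝ) * u.fn T) :
    (l' r).re ≤ 2 * A * ‖v‖ + |ρ| * B * ‖v‖ ^ 2 := by
  have hl : l' r = ∫ T, Complex.I * (-(u.dT T * r.dT T) + ρ * (n T * r.fn T)) := by
    have h := congrArg (fun l : HNeg1 => l r) heq
    simp only [add_apply, smul_apply, zero_apply, smul_eq_mul, dTHNeg1_apply, toHNeg1_apply] at h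
    rw [integral_const_mul, integral_add (integrable_mul_L2 _ _).fun_neg
      ((integrable_mul_L2 _ _).const_mul _), integral_neg, integral_const_mul]
    linear_combination -Complex.I * h + l' r * Complex.I_mul_I
  have hint : Integrable fun T => Complex.I * (-(u.dT T * r.dT T) + ρ * (n T * r.fn T)) :=
    ((integrable_mul_L2 _ _).neg.add ((integrable_mul_L2 _ _).const_mul _)).const_mul _
  have hi1 := (integrable_norm_mul_norm_L2 u.dT v).const_mul 2
  have hi2 := (integrable_sq_norm_L2 v).const_mul (|ρ| * B)
  calc (l' r).re = ∫ T, (Complex.I * (-(u.dT T * r.dT T) + ρ * (n T * r.fn T))).re := by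
        rw [hl]; exact (integral_re hint).symm
    _ ≤ ∫ T, (2 * (‖u.dT T‖ * ‖v T‖) + |ρ| * B * ‖v T‖ ^ 2) := by
        refine integral_mono_ae hint.re (hi1.add hi2) ?_
        filter_upwards [hB, hn, hr, hr', hv] with T h1 h2 h3 h4 h5
        exact re_weighted_flux_le (weight_nonneg hε T) (abs_deriv_weight_le hε T) h1 h2 h3 h4 h5
    _ = 2 * (∫ T, ‖u.dT T‖ * ‖v T‖) + |ρ| * B * ‖v‖ ^ 2 := by
        rw [integral_add hi1 hi2, integral_const_mul, integral_const_mul, ← sq_norm_L2]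
    _ ≤ 2 * A * ‖v‖ + |ρ| * B * ‖v‖ ^ 2 := by
        have := (integral_norm_mul_norm_le u.dT v).trans
          (mul_le_mul_of_nonneg_right hA (norm_nonneg v))
        linarith

/-- The growth estimate for the weighted norm, with a bounded weight. -/
theorem IsLinearizedSolution.norm_mulL_le {ρ L A B ε : ℝ} {Q : ℝ → H2} {W : ℝ → H1}
    (hW : IsLinearizedSolution ρ L Q W) (hε : 0 < ε)
    (hA : ∀ Z ∈ Icc 0 L, ‖(W Z).dT‖ ≤ A)
    (hB : ∀ Z ∈ Icc 0 L, ∀ᵐ T, ‖(Q Z).fn T‖ ^ 2 ≤ B) {Z : ℝ} (hZ : Z ∈ Icc 0 L) :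
    ‖mulL _ (memLp_sqrt_weight hε) (W Z).fn‖ ≤
      (‖mulL _ (memLp_sqrt_weight hε) (W 0).fn‖ + 1) * Real.exp (max (2 * A) (|ρ| * B) * Z) - 1 := by
  obtain ⟨hWc, WZ, N, -, h⟩ := hW
  have hA0 : 0 ≤ A := (norm_nonneg _).trans (hA Z hZ)
  have hC (x : ℝ) : |weight ε x| ≤ max (1 / ε) (2 * √(1 / ε)) := by
    rw [abs_of_nonneg (weight_nonneg hε x)]
    exact (weight_le_inv hε x).trans (le_max_left _ _)
  have hC' (x : ℝ) : |2 * x / (1 + ε * x ^ 2) ^ 2| ≤ max (1 / ε) (2 * √(1 / ε)) := by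
    refine (abs_deriv_weight_le hε x).trans (le_trans ?_ (le_max_right _ _))
    gcongr
    exact weight_le_inv hε x
  obtain ⟨R, hRc, hR⟩ := exists_conjMul (hasDerivAt_weight hε)
    (by refine Continuous.div (by fun_prop) (by fun_prop) fun x => ?_; positivity) hC hC'
  set v : ℝ → L2 := fun z => mulL _ (memLp_sqrt_weight hε) (W z).fn
  have hv (z : ℝ) := mulL_ae _ (memLp_sqrt_weight hε) (W z).fn
  -- The weight is real, so conjugation exchanges `W_y m W̄_z` and `W_z m W̄_y`.
  have hsymm (y z : ℝ) : (toHNeg1 (W y).fn (R (W z))).re = (toHNeg1 (W z).fn (R (W y))).re := by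
    rw [toHNeg1_apply, toHNeg1_apply, ← Complex.conj_re, ← integral_conj]
    congr 1
    refine integral_congr_ae ?_
    filter_upwards [(hR (W y)).1, (hR (W z)).1] with T h1 h2
    rw [h1, h2]
    simp only [map_mul, Complex.conj_conj, Complex.conj_ofReal]
    ring
  have hsq (z : ℝ) : ‖v z‖ ^ 2 = (toHNeg1 (W z).fn (R (W z))).re := by
    have : toHNeg1 (W z).fn (R (W z)) = ((∫ T, ‖v z T‖ ^ 2 : ℝ) : ℂ) := by
      rw [toHNeg1_apply, ← integral_complex_ofReal]
      refine integral_congr_ae ?_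
      filter_upwards [(hR (W z)).1, hv z] with T h1 h2
      rw [h1, h2, norm_mul, Complex.norm_real, mul_pow, Real.norm_eq_abs, sq_abs,
        Real.sq_sqrt (weight_nonneg hε T), ← Complex.normSq_eq_norm_sq, Complex.ofReal_mul,
        ← Complex.mul_conj]
      ring
    rw [this, Complex.ofReal_re, sq_norm_L2]
  have hd (z) (hz : z ∈ Icc 0 L) : HasDerivWithinAt (fun z => ‖v z‖ ^ 2)
      (2 * (WZ z (R (W z))).re) (Icc 0 L) z := by
    simp_rw [hsq]
    exact hasDerivWithinAt_re_pairing (r := fun z => R (W z)) (h z hz).1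
      (hRc.continuousAt.comp_continuousWithinAt (hWc z hz)) fun y _ => hsymm y z
  have key := sqrt_le_of_deriv_le (M := max (2 * A) (|ρ| * B)) (le_max_of_le_left (by linarith)) hd
    (fun z => sq_nonneg _) (fun z hz => by
      have h1 := re_pairing_le hε (hA z hz) (hB z hz) (h z hz).2.1 (h z hz).2.2 (hR (W z)).1
        (hR (W z)).2 (hv z)
      rw [Real.sqrt_sq (norm_nonneg _)]
      have h2 := mul_le_mul_of_nonneg_right (le_max_left (2 * A) (|ρ| * B)) (norm_nonneg (v z))
      have h3 := mul_le_mul_of_nonneg_right (le_max_right (2 * A) (|ρ| * B)) (sq_nonneg ‖v z‖)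
      change (WZ z (R (W z))).re ≤ 2 * A * ‖v z‖ + |ρ| * B * ‖v z‖ ^ 2 at h1
      linarith) hZ
  rwa [Real.sqrt_sq (norm_nonneg _), Real.sqrt_sq (norm_nonneg _)] at key

/-! ### Removing the regularization. -/

theorem sqrt_weight_le_abs {ε : ℝ} (hε : 0 < ε) (T : ℝ) : √(weight ε T) ≤ |T| := by
  rw [← Real.sqrt_sq_eq_abs]
  exact Real.sqrt_le_sqrt (weight_le_sq hε T)

theorem norm_mulL_le_of_ae_eq {ε : ℝ} (hε : 0 < ε) {f V : L2}
    (hV : ∀ᵐ T : ℝ, V T = ((|T| : ℝ) : ℂ) * f T) : ‖mulL _ (memLp_sqrt_weight hε) f‖ ≤ ‖V‖ := by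
  refine Lp.norm_le_norm_of_ae_le ?_
  filter_upwards [hV, mulL_ae _ (memLp_sqrt_weight hε) f] with T h1 h2
  rw [h1, h2, norm_mul, norm_mul, Complex.norm_real, Complex.norm_real, Real.norm_eq_abs,
    Real.norm_eq_abs, abs_abs, abs_of_nonneg (Real.sqrt_nonneg _)]
  gcongr
  exact sqrt_weight_le_abs hε T

/-- Fatou's lemma along `ε = 1/(n+1)`, where `√m` converges pointwise to `|T|`. -/
theorem exists_abs_mul_L2 {f : L2} {K : ℝ}
    (hK : ∀ (ε : ℝ) (hε : 0 < ε), ‖mulL _ (memLp_sqrt_weight hε) f‖ ≤ K) :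
    ∃ V : L2, (∀ᵐ T : ℝ, V T = ((|T| : ℝ) : ℂ) * f T) ∧ ‖V‖ ≤ K := by
  have hp (n : ℕ) : (0 : ℝ) < 1 / ((n : ℝ) + 1) := by positivity
  have hm : AEStronglyMeasurable (fun T : ℝ => ((|T| : ℝ) : ℂ) * f T) volume :=
    (Complex.continuous_ofReal.comp continuous_abs).aestronglyMeasurable.mul
      (Lp.aestronglyMeasurable f)
  have hb : eLpNorm (fun T : ℝ => ((|T| : ℝ) : ℂ) * f T) 2 volume ≤ ENNReal.ofReal K := by
    refine Lp.eLpNorm_le_of_ae_tendsto (u := atTop)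
      (f := fun n : ℕ => ⇑(mulL _ (memLp_sqrt_weight (hp n)) f)) ?_
      (fun n => Lp.aestronglyMeasurable _) ?_
    · refine Eventually.of_forall fun n => ?_
      rw [← ENNReal.ofReal_toReal (Lp.eLpNorm_ne_top (mulL _ (memLp_sqrt_weight (hp n)) f)),
        ← Lp.norm_def]
      exact ENNReal.ofReal_le_ofReal (hK _ (hp n))
    · filter_upwards [ae_all_iff.2 fun n => mulL_ae _ (memLp_sqrt_weight (hp n)) f] with T hT
      simp_rw [hT]
      exact ((Complex.continuous_ofReal.tendsto _).comp (tendsto_sqrt_weight T)).mul_const _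
  have hL : MemLp (fun T : ℝ => ((|T| : ℝ) : ℂ) * f T) 2 := ⟨hm, hb.trans_lt ENNReal.ofReal_lt_top⟩
  refine ⟨hL.toLp _, hL.coeFn_toLp, ?_⟩
  rw [Lp.norm_toLp]
  -- The case `ε = 1` supplies `0 ≤ K`.
  exact ENNReal.toReal_le_of_le_ofReal ((norm_nonneg _).trans (hK 1 one_pos)) hb

/-- Dominated convergence with majorant `|V|²`. Convergence in norm is what yields measurability of
`Z ↦ |T| W(Z)` as an `L²`-valued map. -/
theorem tendsto_mulL_sqrt_weight {f V : L2} (hV : ∀ᵐ T : ℝ, V T = ((|T| : ℝ) : ℂ) * f T) :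
    Tendsto (fun n : ℕ => mulL _ (memLp_sqrt_weight (ε := 1 / ((n : ℝ) + 1)) (by positivity)) f)
      atTop (𝓝 V) := by
  have hp (n : ℕ) : (0 : ℝ) < 1 / ((n : ℝ) + 1) := by positivity
  rw [tendsto_iff_norm_sub_tendsto_zero]
  have key : Tendsto (fun n : ℕ => ‖mulL _ (memLp_sqrt_weight (hp n)) f - V‖ ^ 2) atTop (𝓝 0) := by
    simp_rw [sq_norm_L2]
    have hae : ∀ᵐ T : ℝ, ∀ n : ℕ, (mulL _ (memLp_sqrt_weight (hp n)) f - V) T =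
        ((√(weight (1 / ((n : ℝ) + 1)) T) - |T| : ℝ) : ℂ) * f T := by
      refine ae_all_iff.2 fun n => ?_
      filter_upwards [hV, mulL_ae _ (memLp_sqrt_weight (hp n)) f,
        Lp.coeFn_sub (mulL _ (memLp_sqrt_weight (hp n)) f) V] with T h1 h2 h3
      rw [h3, Pi.sub_apply, h1, h2]
      push_cast
      ring
    have := tendsto_integral_of_dominated_convergence (μ := (volume : Measure ℝ))
      (F := fun n T => ‖(mulL _ (memLp_sqrt_weight (hp n)) f - V) T‖ ^ 2) (f := fun _ => 0)
      (fun T => ‖V T‖ ^ 2) (fun n => (Lp.aestronglyMeasurable _).norm.pow 2)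
      (integrable_sq_norm_L2 V) (fun n => by
        filter_upwards [hae, hV] with T h1 h2
        rw [h1 n, h2, norm_pow, norm_norm, norm_mul, norm_mul, Complex.norm_real, Complex.norm_real,
          Real.norm_eq_abs, Real.norm_eq_abs, abs_abs]
        have h3 := sqrt_weight_le_abs (hp n) T
        have h4 := Real.sqrt_nonneg (weight (1 / ((n : ℝ) + 1)) T)
        have h5 : abs (√(weight (1 / ((n : ℝ) + 1)) T) - |T|) ≤ |T| := by
          rw [abs_le]
          constructor <;> linarith [abs_nonneg T]
        exact pow_le_pow_left₀ (by positivity)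
          (mul_le_mul_of_nonneg_right h5 (norm_nonneg _)) 2) (by
        filter_upwards [hae] with T h1
        simp_rw [h1]
        have h2 : Tendsto (fun n : ℕ => √(weight (1 / ((n : ℝ) + 1)) T) - |T|) atTop (𝓝 0) := by
          simpa using (tendsto_sqrt_weight T).sub_const |T|
        have h3 := (((Complex.continuous_ofReal.tendsto _).comp h2).mul_const (f T)).norm.pow 2
        simpa using h3)
    simpa using this
  have h2 := key.sqrt
  simpa [Real.sqrt_sq (norm_nonneg _)] using h2

theorem continuous_H2_fn : Continuous H2.fn := continuous_fst.comp continuous_subtype_val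

end NLSE

/-! ### The main theorem. -/

open NLSE Filter Topology

theorem proposition3p2 (ρ L : ℝ) (hL : 0 < L) (Q : ℝ → NLSE.H2)
    (hQ : NLSE.IsH2Solution ρ L Q)
    (W : ℝ → NLSE.H1) (hW : ∀ Z ∈ Icc 0 L, W Z = (Q Z).dT) :
    NLSE.IsLinearizedSolution ρ L Q W ∧
    (MemLp (fun T : ℝ => ((|T| : ℝ) : ℂ) * (W 0).fn T) 2 volume →
      ∃ V : ℝ → NLSE.L2,
        (∀ Z ∈ Icc 0 L, ∀ᵐ T : ℝ, V Z T = ((|T| : ℝ) : ℂ) * (W Z).fn T) ∧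
        MemLp V ∞ (volume.restrict (Icc 0 L)) ∧
        (∀ Z ∈ Icc 0 L, MemLp (Q Z).fn ∞ volume) ∧
        ∃ A B : ℝ,
          IsLUB ((fun Z => ‖(W Z).dT‖) '' Icc 0 L) A ∧
          IsLUB ((fun Z => (eLpNorm (Q Z).fn ∞ volume).toReal ^ 2) '' Icc 0 L) B ∧
          ∀ Z ∈ Icc 0 L,
            ‖V Z‖ ≤ (‖V 0‖ + 1) * Real.exp (max (2 * A) (|ρ| * B) * Z) - 1) := by
  have hlin := hQ.isLinearizedSolution hW
  refine ⟨hlin, fun h0 => ?_⟩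
  have h0mem : (0 : ℝ) ∈ Icc 0 L := left_mem_Icc.2 hL.le
  have hne : (Icc 0 L).Nonempty := ⟨0, h0mem⟩
  have hQb (Z : ℝ) : ∀ᵐ T, ‖(Q Z).fn T‖ ≤ ‖(Q Z).fn‖ + ‖(Q Z).dT.fn‖ :=
    HasWeakDeriv.ae_norm_le (Q Z).2.1
  have hQm (Z : ℝ) : MemLp (Q Z).fn ∞ volume :=
    memLp_top_of_bound (Lp.aestronglyMeasurable _) _ (hQb Z)
  have hA : BddAbove ((fun Z => ‖(W Z).dT‖) '' Icc 0 L) :=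
    isCompact_Icc.bddAbove_image (H1.dT.continuous.comp_continuousOn hlin.1).norm
  have hB : BddAbove ((fun Z => (eLpNorm (Q Z).fn ∞ volume).toReal ^ 2) '' Icc 0 L) := by
    have hc : ContinuousOn (fun Z => (‖(Q Z).fn‖ + ‖(Q Z).dT.fn‖) ^ 2) (Icc 0 L) :=
      ((continuous_H2_fn.comp_continuousOn hQ.1).norm.add
        ((H1.fn.continuous.comp continuous_H2_dT).comp_continuousOn hQ.1).norm).pow 2
    obtain ⟨K, hK⟩ := isCompact_Icc.bddAbove_image hc
    refine ⟨K, ?_⟩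
    rintro _ ⟨Z, hZ, rfl⟩
    refine le_trans ?_ (hK ⟨Z, hZ, rfl⟩)
    have : (eLpNorm (Q Z).fn ∞ volume).toReal ≤ ‖(Q Z).fn‖ + ‖(Q Z).dT.fn‖ := by
      refine ENNReal.toReal_le_of_le_ofReal (by positivity) ?_
      rw [eLpNorm_exponent_top]
      exact eLpNormEssSup_le_of_ae_bound (hQb Z)
    dsimp only
    gcongr
  obtain ⟨A, hA⟩ : ∃ A, IsLUB ((fun Z => ‖(W Z).dT‖) '' Icc 0 L) A :=
    ⟨_, isLUB_csSup (hne.image _) hA⟩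
  obtain ⟨B, hB⟩ : ∃ B, IsLUB ((fun Z => (eLpNorm (Q Z).fn ∞ volume).toReal ^ 2) '' Icc 0 L) B :=
    ⟨_, isLUB_csSup (hne.image _) hB⟩
  have hA' (Z) (hZ : Z ∈ Icc 0 L) : ‖(W Z).dT‖ ≤ A := hA.1 ⟨Z, hZ, rfl⟩
  have hB' (Z) (hZ : Z ∈ Icc 0 L) : ∀ᵐ T, ‖(Q Z).fn T‖ ^ 2 ≤ B := by
    filter_upwards [ae_le_eLpNormEssSup (f := (Q Z).fn) (μ := volume)] with T hT
    refine le_trans ?_ (hB.1 ⟨Z, hZ, rfl⟩)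
    dsimp only
    gcongr
    rw [← eLpNorm_exponent_top] at hT
    simpa using ENNReal.toReal_mono (hQm Z).2.ne hT
  set M := max (2 * A) (|ρ| * B)
  have hM : 0 ≤ M := le_max_of_le_left (by linarith [(norm_nonneg _).trans (hA' 0 h0mem)])
  have hV₀ := h0.coeFn_toLp
  set V₀ : L2 := h0.toLp _
  -- `V` is chosen separately for each `Z`, with no constraint outside `[0, L]`; its measurability
  -- in `Z` is proved afterwards.
  have hex (Z : ℝ) : ∃ V : L2, Z ∈ Icc 0 L → (∀ᵐ T : ℝ, V T = ((|T| : ℝ) : ℂ) * (W Z).fn T) ∧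
      ‖V‖ ≤ (‖V₀‖ + 1) * Real.exp (M * Z) - 1 := by
    by_cases hZ : Z ∈ Icc 0 L
    · obtain ⟨V, hV⟩ := exists_abs_mul_L2 (f := (W Z).fn)
        (K := (‖V₀‖ + 1) * Real.exp (M * Z) - 1) fun ε hε =>
          (hlin.norm_mulL_le hε hA' hB' hZ).trans (by
            gcongr
            exact norm_mulL_le_of_ae_eq hε hV₀)
      exact ⟨V, fun _ => hV⟩
    · exact ⟨0, fun h => absurd h hZ⟩
  choose V hV using hex
  have hV0 : V 0 = V₀ := by
    refine Lp.ext ?_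
    filter_upwards [(hV 0 h0mem).1, hV₀] with T h1 h2
    rw [h1, h2]
  refine ⟨V, fun Z hZ => (hV Z hZ).1, ?_, fun Z _ => hQm Z, A, B, hA, hB, fun Z hZ => ?_⟩
  · refine memLp_top_of_bound ?_ ((‖V₀‖ + 1) * Real.exp (M * L) - 1) ?_
    -- For each fixed `ε` the weighted curve is continuous on `[0, L]`, because `W` is continuous
    -- into `L²` and the multiplier is bounded.
    · refine aestronglyMeasurable_of_tendsto_ae atTop (f := fun (n : ℕ) Z =>
        mulL _ (memLp_sqrt_weight (ε := 1 / ((n : ℝ) + 1)) (by positivity)) (W Z).fn)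
        (fun n => ContinuousOn.aestronglyMeasurable ?_ measurableSet_Icc) ?_
      · exact (ContinuousLinearMap.continuous _).comp_continuousOn
          (H1.fn.continuous.comp_continuousOn hlin.1)
      · filter_upwards [ae_restrict_mem measurableSet_Icc] with Z hZ
        exact tendsto_mulL_sqrt_weight (hV Z hZ).1
    · filter_upwards [ae_restrict_mem measurableSet_Icc] with Z hZ
      refine (hV Z hZ).2.trans ?_
      gcongr
      exact hZ.2
  · rw [hV0]
    exact (hV Z hZ).2
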